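/- For a complex square matrix $X$ let $\operatorname{Im}X=(X-X^*)/(2i)$, let $W(X)=\{\langle Xh,h\rangle:\ \|h\|=1\}$ be its numerical range, and let $P_X(\lambda,\theta)=\det\bigl(\lambda I-\operatorname{Im}(e^{-i\theta}X)\bigr)$ be its NR generating polynomial. A subset of $\mathbb C$ is called bi-elliptical if it is the convex hull of two non-degenerate ellipses with distinct centers, neither of which is contained in the elliptical disk bounded by the other. Let $\alpha=u+iv\in\mathbb C$ $(u,v\in\mathbb R)$, let $B\in\mathbb C^{2\times 2}$, and let $$A=\begin{bmatrix}\alpha I & B^*+I\\ B-I & -\alpha I\end{bmatrix}\in\mathbb C^{4\times 4}.$$ Let $\beta_1,\beta_2$ be the eigenvalues of $\operatorname{Im}B$, counted with multiplicity. The eigenvalues of $A$, counted with multiplicity, have the form $\pm\sigma_1,\pm\sigma_2$. Then $W(A)$ is bi-elliptical if and only if $B$ is not normal and, for an appropriate choice of the signs of $\sigma_1,\sigma_2$, $$(1+v^2)(\sigma_1+\sigma_2)^2=(\beta_1-\beta_2)^2.\qquad(*)$$ Moreover, if $B$ is not normal and $(*)$ holds for an appropriate choice of signs, set, with the Frobenius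 norm $\|B\|_F$, $$p=\frac{|\beta_1-\beta_2|}{2\sqrt{1+v^2}},\quad x=\frac{\|B\|_F^2-2}{4}+\frac{\operatorname{Re}(\alpha^2)}2-\frac{p^2}2,\quad y=\frac{\beta_1+\beta_2}2+\frac{\operatorname{Im}(\alpha^2)}2,\quad z=\frac{\|B\|_F^2+2}{4}+\frac{|\alpha|^2}2-\frac{p^2}2,$$ and $\Omega(\theta)=x\cos2\theta+y\sin2\theta-z$. Then $p>0$, $z>\sqrt{x^2+y^2}$, and, for all $\theta\in\mathbb R$, $$P_A(\lambda,\theta)=\bigl((\lambda+p\sin\theta)^2+\Omega(\theta)\bigr)\bigl((\lambda-p\sin\theta)^2+\Omega(\theta)\bigr)$$ as polynomials in $\lambda$. -/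

import Mathlib

open scoped ComplexStarModule Matrix

/-- The numerical range `W(A) = {⟨Ax, x⟩ : ‖x‖ = 1}` of a complex square matrix. The inner product
of Mathlib is linear in its second argument, so `⟨Ax, x⟩` reads `inner ℂ x (A x)`. -/
def numericalRange {n : Type*} [Fintype n] [DecidableEq n] (A : Matrix n n ℂ) : Set ℂ :=
  {w | ∃ x : EuclideanSpace ℂ n, ‖x‖ = 1 ∧ w = inner ℂ x (Matrix.toEuclideanLin A x)}

/-- The NR generating polynomial of `A` at the angle `θ`: the characteristic polynomial (in `λ`)
of the hermitian matrix `Im (e^{-iθ} A)`. -/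
noncomputable def nrPoly {n : Type*} [Fintype n] [DecidableEq n] (A : Matrix n n ℂ) (θ : ℝ) :
    Polynomial ℂ :=
  (ℑ (Complex.exp (-(Complex.I * θ)) • A) : Matrix n n ℂ).charpoly

/-- `E` is a (non-degenerate) ellipse in the complex plane with center `c`: a curve with positive
semi-axes `a`, `b`, rotated by an angle `φ` and translated by `c`. -/
def IsEllipse (E : Set ℂ) (c : ℂ) : Prop :=
  ∃ a b φ : ℝ, 0 < a ∧ 0 < b ∧
    E = Set.range fun t : ℝ =>
      c + Complex.exp (φ * Complex.I) * ((a * Real.cos t : ℝ) + (b * Real.sin t : ℝ) * Complex.I)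

/-- A set in the plane is bi-elliptical if it is the convex hull of two non-degenerate ellipses
with distinct centers. Neither ellipse may be redundant, that is, contained in the elliptical disk
bounded by the other one: otherwise the convex hull is just an elliptical disk. -/
def IsBiElliptical (W : Set ℂ) : Prop :=
  ∃ (E₁ E₂ : Set ℂ) (c₁ c₂ : ℂ), IsEllipse E₁ c₁ ∧ IsEllipse E₂ c₂ ∧ c₁ ≠ c₂ ∧
    ¬ E₁ ⊆ convexHull ℝ E₂ ∧ ¬ E₂ ⊆ convexHull ℝ E₁ ∧ W = convexHull ℝ (E₁ ∪ E₂)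

/-- The 4-by-4 matrix `[[αI, B* + I], [B - I, -αI]]`. -/
def blockMat (α : ℂ) (B : Matrix (Fin 2) (Fin 2) ℂ) :
    Matrix (Fin 2 ⊕ Fin 2) (Fin 2 ⊕ Fin 2) ℂ :=
  Matrix.fromBlocks (α • 1) (Bᴴ + 1) (B - 1) (-(α • 1))

/-- With `α = u + iv`, the eigenvalues of `blockMat α B`, counted with multiplicity, are
`±σ₁, ±σ₂`, where the signs can be chosen so that `(1 + v²)(σ₁ + σ₂)² = (β₁ - β₂)²`. -/
def SpectralCondition (α : ℂ) (B : Matrix (Fin 2) (Fin 2) ℂ) (β₁ β₂ : ℝ) : Prop :=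
  ∃ σ₁ σ₂ : ℂ, (blockMat α B).charpoly.roots = {σ₁, -σ₁, σ₂, -σ₂} ∧
    (1 + (α.im : ℂ) ^ 2) * (σ₁ + σ₂) ^ 2 = ((β₁ : ℂ) - (β₂ : ℂ)) ^ 2

/-!
Write `s = sin θ`, `c = cos θ` and, in Pauli coordinates, `B = (r₀ + i j₀) I + (r + i j) · σ` with
real `r₀`, `j₀` and real 3-vectors `r`, `j`; thus `Im B = j₀ I + j · σ` and `(β₁ - β₂)² = 4 |j|²`.
The hermitian matrix `Im (e^{-iθ} A)` has scalar diagonal blocks `±a I`, so that its characteristic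
polynomial is biquadratic in `λ` and equals `(λ² - T)² - s² N` (`nrPoly_blockMat`). Here `T` and `N`
are quadratic forms in `(s, c)`: `T` is the mean form, and `N = |s G - 2 c j|²` the gap form, where
`G` is the vector part of `B* B`. By the formula `G = 2 (r₀ r + j₀ j) - 2 r × j`, the form `N` is
positive definite exactly when `r × j ≠ 0`, which is to say that `B` is not normal (`gapForm_pos`,
`exists_gapForm_eq_zero`).

The stated factorization means that `N = 4 p² (T - p² s²)`, with `Ω = -(T - p² s²)`. This is an
equality of quadratic forms. Its `c²` coefficient gives the value of `p`; given that, the other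
two are the real and the imaginary part of the spectral condition (`spectralCondition_iff`). For a matrix
that is not normal, `N > 0` yields `p > 0` and `Ω < 0`.

The link with the numerical range is that the largest root of the NR generating polynomial at `θ` is
the maximum of `Im (e^{-iθ} w)` over `w ∈ W(A)` (`isGreatest_imRot_iff`), a form of the support
function. If the factorization holds, this maximum is `p |s| + √(-Ω)`, the support function of the
convex hull of two ellipses with centers `±p`; since `W(A)` is compact, and convex by the
Toeplitz–Hausdorff theorem, it is that convex hull (`isBiElliptical_of_nrPoly`).

Conversely, let `W(A)` be the convex hull of two ellipses, with support functions `ℓ₁ + √q₁` and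
`ℓ₂ + √q₂`. Neither ellipse is redundant, so each function is the larger one on an open set of angles,
and is a root of the polynomial there, hence everywhere by analyticity (`root_of_root_max`). For an
ellipse with center `≠ 0`, the symmetries `θ ↦ θ + π` and `λ ↦ -λ` then give the four roots
`±ℓ ± √q`, so that `T = q + ℓ²` and `s² N = 4 ℓ² q`. Evaluation at `s = 0` shows that `ℓ` is a
multiple of `s`, and the identity between `N` and `T` follows (`gapForm_eq_of_root`).
-/

/-! ### Pauli coordinates and characteristic polynomials -/

open Polynomial in
theorem charpoly_fromBlocks_scalar {R : Type*} [CommRing R] (a : R)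
    (K L : Matrix (Fin 2) (Fin 2) R) :
    (Matrix.fromBlocks (a • 1) K L (-(a • 1))).charpoly =
      (X ^ 2 - C (a ^ 2)) ^ 2 - C ((K * L).trace) * (X ^ 2 - C (a ^ 2)) + C ((K * L).det) := by
  have h : (Matrix.fromBlocks (a • 1) K L (-(a • 1))).charmatrix =
      Matrix.fromBlocks ((X - C a) • (1 : Matrix (Fin 2) (Fin 2) R[X])) (-(K.map C)) (-(L.map C))
        ((X + C a) • 1) := by
    rw [Matrix.charmatrix_fromBlocks]
    congr 1
    · ext i j : 1
      fin_cases i <;> fin_cases j <;> simp [Matrix.charmatrix]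
    · ext i j : 1
      fin_cases i <;> fin_cases j <;> simp [Matrix.charmatrix]
  obtain ⟨e, e0, e1, e2, e3⟩ : ∃ e : Fin 4 ≃ Fin 2 ⊕ Fin 2,
      e 0 = Sum.inl 0 ∧ e 1 = Sum.inl 1 ∧ e 2 = Sum.inr 0 ∧ e 3 = Sum.inr 1 :=
    ⟨(finSumFinEquiv (m := 2) (n := 2)).symm, rfl, rfl, rfl, rfl⟩
  rw [Matrix.charpoly, h, ← Matrix.det_submatrix_equiv_self e, Matrix.det_succ_row_zero]
  simp only [Fin.sum_univ_four, Matrix.det_fin_three, Matrix.submatrix_apply]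
  simp only [Matrix.trace_fin_two, Matrix.det_fin_two, Matrix.mul_apply, Fin.sum_univ_two, C_add,
    C_mul, C_pow, C_sub]
  simp [Fin.succAbove, Fin.lt_def, e0, e1, e2, e3]
  ring

/-- The matrix `(r₀ + i j₀) I + ∑ₖ (rₖ + i jₖ) σₖ`, where `σ₁, σ₂, σ₃` are the Pauli matrices. Its
real and imaginary (hermitian) parts have the coordinates `r` and `j`. -/
def pauli (r j : Fin 4 → ℝ) : Matrix (Fin 2) (Fin 2) ℂ :=
  !![⟨r 0 + r 3, j 0 + j 3⟩, ⟨r 1 + j 2, j 1 - r 2⟩;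
     ⟨r 1 - j 2, r 2 + j 1⟩, ⟨r 0 - r 3, j 0 - j 3⟩]

theorem exists_eq_pauli (B : Matrix (Fin 2) (Fin 2) ℂ) : ∃ r j, B = pauli r j := by
  refine ⟨![((B 0 0).re + (B 1 1).re) / 2, ((B 0 1).re + (B 1 0).re) / 2,
    ((B 1 0).im - (B 0 1).im) / 2, ((B 0 0).re - (B 1 1).re) / 2],
    ![((B 0 0).im + (B 1 1).im) / 2, ((B 0 1).im + (B 1 0).im) / 2,
    ((B 0 1).re - (B 1 0).re) / 2, ((B 0 0).im - (B 1 1).im) / 2], ?_⟩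
  ext i k
  fin_cases i <;> fin_cases k <;> apply Complex.ext <;> simp [pauli] <;> ring

/-- The vector part `G = 2 (r₀ r + j₀ j) - 2 r × j` of `B* B` in Pauli coordinates, where
`B = pauli r j`. -/
def gramVec (r j : Fin 4 → ℝ) : Fin 3 → ℝ :=
  ![2 * (r 0 * r 1 + j 0 * j 1) - 2 * (r 2 * j 3 - r 3 * j 2),
    2 * (r 0 * r 2 + j 0 * j 2) - 2 * (r 3 * j 1 - r 1 * j 3),
    2 * (r 0 * r 3 + j 0 * j 3) - 2 * (r 1 * j 2 - r 2 * j 1)]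

/-- Half of the squared Frobenius norm of `pauli r j`. -/
def normHalf (r j : Fin 4 → ℝ) : ℝ := ∑ k, (r k ^ 2 + j k ^ 2)

/-- The quadratic form `N = |s G - 2 c j|²` in `(s, c)`. With `s = sin θ` and `c = cos θ`, `±|s| √N`
is the deviation of the squared eigenvalues of `Im (e^{-iθ} A)` from their mean. -/
def gapForm (r j : Fin 4 → ℝ) (s c : ℝ) : ℝ :=
  (s * gramVec r j 0 - 2 * c * j 1) ^ 2 + (s * gramVec r j 1 - 2 * c * j 2) ^ 2 +
    (s * gramVec r j 2 - 2 * c * j 3) ^ 2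

/-- The quadratic form `T` in `(s, c)` that, for `s = sin θ` and `c = cos θ`, gives the mean of
the squared eigenvalues of `Im (e^{-iθ} A)`, where `A = blockMat α (pauli r j)`. -/
def meanForm (α : ℂ) (r j : Fin 4 → ℝ) (s c : ℝ) : ℝ :=
  (α.im * c - α.re * s) ^ 2 + s ^ 2 * normHalf r j - 2 * s * c * j 0 + c ^ 2

theorem exp_neg_I_mul (θ : ℝ) : Complex.exp (-(Complex.I * θ)) = ⟨Real.cos θ, -Real.sin θ⟩ := by
  rw [show -(Complex.I * θ) = ((-θ : ℝ) : ℂ) * Complex.I by push_cast; ring, Complex.exp_mul_I]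
  apply Complex.ext <;> simp [← Complex.ofReal_cos, ← Complex.ofReal_sin]

theorem imaginaryPart_matrix {n : Type*} (M : Matrix n n ℂ) (i k : n) :
    (ℑ M : Matrix n n ℂ) i k = -Complex.I * ((M i k - star (M k i)) / 2) := by
  rw [imaginaryPart_apply_coe]
  simp [Matrix.star_eq_conjTranspose, Matrix.conjTranspose_apply, Algebra.smul_def]
  ring

theorem imaginaryPart_blockMat (α : ℂ) (B : Matrix (Fin 2) (Fin 2) ℂ) (θ : ℝ) :
    (ℑ (Complex.exp (-(Complex.I * θ)) • blockMat α B) : Matrix _ _ ℂ) =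
      Matrix.fromBlocks
        (((α.im * Real.cos θ - α.re * Real.sin θ : ℝ) : ℂ) • 1)
        (-((Real.sin θ : ℂ) • Bᴴ + (Complex.I * Real.cos θ) • 1))
        (-((Real.sin θ : ℂ) • B - (Complex.I * Real.cos θ) • 1))
        (-(((α.im * Real.cos θ - α.re * Real.sin θ : ℝ) : ℂ) • 1)) := by
  rw [exp_neg_I_mul]
  generalize Real.sin θ = s
  generalize Real.cos θ = c
  ext i k
  rw [imaginaryPart_matrix]
  rcases i with i | i <;> rcases k with k | k <;> fin_cases i <;> fin_cases k <;>
    apply Complex.ext <;> simp [blockMat] <;> ring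

open Polynomial in
theorem nrPoly_blockMat (α : ℂ) (r j : Fin 4 → ℝ) (θ : ℝ) :
    nrPoly (blockMat α (pauli r j)) θ =
      X ^ 4 - C ((2 * meanForm α r j (Real.sin θ) (Real.cos θ) : ℝ) : ℂ) * X ^ 2 +
        C ((meanForm α r j (Real.sin θ) (Real.cos θ) ^ 2 -
          Real.sin θ ^ 2 * gapForm r j (Real.sin θ) (Real.cos θ) : ℝ) : ℂ) := by
  rw [nrPoly, imaginaryPart_blockMat, charpoly_fromBlocks_scalar]
  generalize Real.sin θ = s
  generalize Real.cos θ = c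
  set a := α.im * c - α.re * s with ha
  set K := (-((s : ℂ) • (pauli r j)ᴴ + (Complex.I * c) • 1)) *
    (-((s : ℂ) • (pauli r j) - (Complex.I * c) • 1)) with hK
  have ht : K.trace = ((2 * (meanForm α r j s c - a ^ 2) : ℝ) : ℂ) := by
    apply Complex.ext
    · rw [Complex.ofReal_re]
      simp [hK, Matrix.trace_fin_two, Matrix.mul_apply, pauli, meanForm, normHalf,
        Fin.sum_univ_four, ha]
      ring
    · rw [Complex.ofReal_im]
      simp [hK, Matrix.trace_fin_two, Matrix.mul_apply, pauli]
      ring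
  have hd : K.det = (((meanForm α r j s c - a ^ 2) ^ 2 - s ^ 2 * gapForm r j s c : ℝ) : ℂ) := by
    rw [hK, Matrix.det_mul, Matrix.det_fin_two, Matrix.det_fin_two]
    apply Complex.ext
    · rw [Complex.ofReal_re]
      simp [pauli, meanForm, normHalf, gapForm, gramVec, Fin.sum_univ_four, ha]
      ring
    · rw [Complex.ofReal_im]
      simp [pauli]
      ring
  rw [ht, hd]
  simp only [Complex.ofReal_mul, Complex.ofReal_sub, Complex.ofReal_pow, Complex.ofReal_ofNat,
    C_mul, C_sub, C_pow]
  rw [show (C (2 : ℂ)) = 2 from rfl]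
  ring

open Polynomial in
theorem charpoly_blockMat (α : ℂ) (r j : Fin 4 → ℝ) :
    ∃ t d : ℂ, (blockMat α (pauli r j)).charpoly = X ^ 4 - C t * X ^ 2 + C d ∧
      t = ⟨2 * (α.re ^ 2 - α.im ^ 2 - 1 + normHalf r j), 4 * (α.re * α.im + j 0)⟩ ∧
      t ^ 2 - 4 * d =
        ⟨4 * (gapForm r j 1 0 - gapForm r j 0 1),
         16 * (gramVec r j 0 * j 1 + gramVec r j 1 * j 2 + gramVec r j 2 * j 3)⟩ := by
  refine ⟨_, (⟨2 * (α.re ^ 2 - α.im ^ 2 - 1 + normHalf r j), 4 * (α.re * α.im + j 0)⟩ ^ 2 -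
      ⟨4 * (gapForm r j 1 0 - gapForm r j 0 1),
         16 * (gramVec r j 0 * j 1 + gramVec r j 1 * j 2 + gramVec r j 2 * j 3)⟩) / 4,
    ?_, rfl, ?_⟩
  · rw [blockMat, charpoly_fromBlocks_scalar]
    set K := ((pauli r j)ᴴ + 1) * (pauli r j - 1) with hK
    have ht : (⟨2 * (α.re ^ 2 - α.im ^ 2 - 1 + normHalf r j), 4 * (α.re * α.im + j 0)⟩ : ℂ) =
        K.trace + 2 * α ^ 2 := by
      apply Complex.ext <;> simp [hK, Matrix.trace_fin_two, Matrix.mul_apply, pauli, normHalf,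
        Fin.sum_univ_four, sq] <;> ring
    have hd : (⟨4 * (gapForm r j 1 0 - gapForm r j 0 1),
         16 * (gramVec r j 0 * j 1 + gramVec r j 1 * j 2 + gramVec r j 2 * j 3)⟩ : ℂ) =
        K.trace ^ 2 - 4 * K.det := by
      rw [hK, Matrix.det_mul, Matrix.trace_fin_two, Matrix.det_fin_two, Matrix.det_fin_two]
      apply Complex.ext <;> simp [Matrix.mul_apply, pauli, gapForm, gramVec, sq] <;>
        ring
    rw [ht, hd, show ((K.trace + 2 * α ^ 2) ^ 2 - (K.trace ^ 2 - 4 * K.det)) / 4 =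
      α ^ 4 + α ^ 2 * K.trace + K.det by ring]
    simp only [C_mul, C_add, C_pow]
    rw [show (C (2 : ℂ)) = 2 from rfl]
    ring
  · ring

theorem imaginaryPart_pauli_roots {r j : Fin 4 → ℝ} {β₁ β₂ : ℝ}
    (hβ : (ℑ (pauli r j) : Matrix (Fin 2) (Fin 2) ℂ).charpoly.roots = {(β₁ : ℂ), (β₂ : ℂ)}) :
    β₁ + β₂ = 2 * j 0 ∧ (β₁ - β₂) ^ 2 = 4 * (j 1 ^ 2 + j 2 ^ 2 + j 3 ^ 2) := by
  have ht := Matrix.trace_eq_sum_roots_charpoly (ℑ (pauli r j) : Matrix (Fin 2) (Fin 2) ℂ)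
  have hd := Matrix.det_eq_prod_roots_charpoly (ℑ (pauli r j) : Matrix (Fin 2) (Fin 2) ℂ)
  rw [hβ, Matrix.trace_fin_two] at ht
  rw [hβ, Matrix.det_fin_two] at hd
  simp only [imaginaryPart_matrix] at ht hd
  have ht' := congrArg Complex.re ht
  have hd' := congrArg Complex.re hd
  simp [pauli] at ht' hd'
  have h1 : β₁ + β₂ = 2 * j 0 := by linarith
  refine ⟨h1, ?_⟩
  have : (β₁ - β₂) ^ 2 = (β₁ + β₂) ^ 2 - 4 * (β₁ * β₂) := by ring
  rw [this, h1, ← hd']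
  ring

theorem sum_norm_sq_pauli (r j : Fin 4 → ℝ) :
    ∑ i, ∑ k, ‖pauli r j i k‖ ^ 2 = 2 * normHalf r j := by
  simp [Complex.sq_norm, Complex.normSq_apply, pauli, normHalf, Fin.sum_univ_four]
  ring

theorem isStarNormal_pauli_iff (r j : Fin 4 → ℝ) :
    IsStarNormal (pauli r j) ↔ r 2 * j 3 = r 3 * j 2 ∧ r 3 * j 1 = r 1 * j 3 ∧
      r 1 * j 2 = r 2 * j 1 := by
  rw [isStarNormal_iff, commute_iff_eq, Matrix.star_eq_conjTranspose]
  constructor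
  · intro h
    have h0 := congrArg Complex.re (congrFun (congrFun h 0) 0)
    have h1 := congrArg Complex.re (congrFun (congrFun h 0) 1)
    have h2 := congrArg Complex.im (congrFun (congrFun h 0) 1)
    simp [Matrix.mul_apply, pauli] at h0 h1 h2
    refine ⟨?_, ?_, ?_⟩ <;> linarith
  · rintro ⟨h1, h2, h3⟩
    ext i k
    fin_cases i <;> fin_cases k <;> apply Complex.ext <;> simp [Matrix.mul_apply, pauli] <;>
      linarith

/-! ### The spectral condition and the factorization -/

theorem gapForm_eq (r j : Fin 4 → ℝ) (s c : ℝ) :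
    gapForm r j s c = s ^ 2 * gapForm r j 1 0 -
      4 * s * c * (gramVec r j 0 * j 1 + gramVec r j 1 * j 2 + gramVec r j 2 * j 3) +
      c ^ 2 * gapForm r j 0 1 := by
  simp only [gapForm]
  ring

open Polynomial in
/-- For the signs of the roots `±σ₁, ±σ₂` of `X⁴ - t X² + d` to be compatible with
`(σ₁ + σ₂)² = w` means that `w - t = 2 σ₁ σ₂` for one of the two square roots `σ₁ σ₂` of `d`. -/
theorem exists_roots_eq_iff {f : ℂ[X]} {t d : ℂ} (hf : f = X ^ 4 - C t * X ^ 2 + C d) (w : ℂ) :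
    (∃ σ₁ σ₂ : ℂ, f.roots = {σ₁, -σ₁, σ₂, -σ₂} ∧ (σ₁ + σ₂) ^ 2 = w) ↔
      (w - t) ^ 2 = 4 * d := by
  constructor
  · rintro ⟨σ₁, σ₂, h, hw⟩
    have hmon : f.Monic := by rw [hf]; monicity!
    have hp := (IsAlgClosed.splits f).eq_prod_roots_of_monic hmon
    rw [h, hf] at hp
    have h0 := congrArg (eval 0) hp
    have h1 := congrArg (eval 1) hp
    simp at h0 h1
    have ht : t = σ₁ ^ 2 + σ₂ ^ 2 := by linear_combination h0 - h1
    rw [← hw, ht, h0]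
    ring
  · intro h
    obtain ⟨m, hm⟩ := IsAlgClosed.exists_pow_nat_eq w two_pos
    obtain ⟨τ, hτ⟩ := IsAlgClosed.exists_pow_nat_eq (m ^ 2 / 4 - (w - t) / 2) two_pos
    refine ⟨m / 2 + τ, m / 2 - τ, ?_, by rw [← hm]; ring⟩
    have : f = (Multiset.map (fun a => X - C a)
        {m / 2 + τ, -(m / 2 + τ), m / 2 - τ, -(m / 2 - τ)}).prod := by
      have ht : t = 2 * (m ^ 2 / 4 + τ ^ 2) := by linear_combination -hm - 2 * hτ
      have hd : d = (m ^ 2 / 4 - τ ^ 2) ^ 2 := by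
        rw [hτ]; linear_combination - h / 4
      rw [hf, ht, hd]
      simp only [Multiset.insert_eq_cons, Multiset.map_cons, Multiset.prod_cons,
        Multiset.map_singleton, Multiset.prod_singleton]
      have e1 : (C (2 * (m ^ 2 / 4 + τ ^ 2)) : ℂ[X]) = 2 * (C (m / 2) ^ 2 + C τ ^ 2) := by
        rw [show (2 : ℂ[X]) = C 2 from rfl, ← C_pow, ← C_pow, ← C_add, ← C_mul]; congr 1; ring
      have e2 : (C ((m ^ 2 / 4 - τ ^ 2) ^ 2) : ℂ[X]) = (C (m / 2) ^ 2 - C τ ^ 2) ^ 2 := by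
        rw [← C_pow, ← C_pow, ← C_sub, ← C_pow]; congr 1; ring
      rw [e1, e2]
      simp only [C_neg, C_add, C_sub]
      ring
    rw [this, roots_multiset_prod_X_sub_C]

/-- With `P = p²`, the spectral condition is the identity `N = 4P (T - P s²)` between the gap form
`N` and the mean form `T`. The coefficient of `c²` in this identity is the definition of `P`; given it,
the coefficients of `s²` and `s c` are the real and the imaginary part of the spectral condition. -/
theorem spectralCondition_iff (α : ℂ) {r j : Fin 4 → ℝ} {β₁ β₂ P : ℝ}
    (hβ : (β₁ - β₂) ^ 2 = 4 * (j 1 ^ 2 + j 2 ^ 2 + j 3 ^ 2))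
    (hP : P * (1 + α.im ^ 2) = j 1 ^ 2 + j 2 ^ 2 + j 3 ^ 2) :
    SpectralCondition α (pauli r j) β₁ β₂ ↔
      ∀ s c, gapForm r j s c = 4 * P * (meanForm α r j s c - P * s ^ 2) := by
  obtain ⟨t, d, hf, ht, hd⟩ := charpoly_blockMat α r j
  have hv : (1 + (α.im : ℂ) ^ 2) ≠ 0 := by
    have : (1 + α.im ^ 2 : ℝ) ≠ 0 := by positivity
    exact_mod_cast this
  have key : ∀ σ₁ σ₂ : ℂ, (1 + (α.im : ℂ) ^ 2) * (σ₁ + σ₂) ^ 2 = ((β₁ : ℂ) - (β₂ : ℂ)) ^ 2 ↔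
      (σ₁ + σ₂) ^ 2 = ((4 * P : ℝ) : ℂ) := by
    intro σ₁ σ₂
    have : ((β₁ : ℂ) - (β₂ : ℂ)) ^ 2 = (1 + (α.im : ℂ) ^ 2) * ((4 * P : ℝ) : ℂ) := by
      rw [← hP] at hβ
      have := congrArg (fun y : ℝ => (y : ℂ)) hβ
      push_cast at this ⊢
      rw [this]; ring
    rw [this, mul_right_inj' hv]
  simp only [SpectralCondition, key]
  rw [exists_roots_eq_iff hf]
  have h2 : ((((4 * P : ℝ) : ℂ) - t) ^ 2 = 4 * d) ↔
      ((4 * P : ℝ) : ℂ) ^ 2 - 2 * ((4 * P : ℝ) : ℂ) * t + (t ^ 2 - 4 * d) = 0 := by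
    constructor <;> intro h <;> linear_combination h
  have hj : gapForm r j 0 1 = 4 * (P * (1 + α.im ^ 2)) := by
    rw [hP, gapForm]; ring
  rw [h2, hd, ht, Complex.ext_iff]
  simp only [sq, Complex.add_re, Complex.sub_re, Complex.mul_re, Complex.ofReal_re,
    Complex.ofReal_im, Complex.add_im, Complex.sub_im, Complex.mul_im, Complex.re_ofNat,
    Complex.im_ofNat, Complex.zero_re, Complex.zero_im]
  constructor
  · rintro ⟨h3, h4⟩ s c
    simp only [← sq]
    rw [gapForm_eq, meanForm]
    linear_combination s ^ 2 * h3 / 4 - s * c * h4 / 4 + (s ^ 2 + c ^ 2) * hj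
  · intro h
    have h5 := h 1 0
    have h6 := h 1 1
    rw [gapForm_eq] at h6
    simp only [meanForm] at h5 h6
    constructor
    · linear_combination 4 * h5 - 4 * hj
    · linear_combination -4 * h6 + 4 * h5 + 4 * hj

/-- If `B` is not normal, then `r × j ≠ 0`, and `G` and `j` are linearly independent because
`G · (r × j) = -2 |r × j|²` while `j · (r × j) = 0`. -/
theorem gapForm_pos {r j : Fin 4 → ℝ} (h : ¬ IsStarNormal (pauli r j)) {s c : ℝ}
    (hsc : s ≠ 0 ∨ c ≠ 0) : 0 < gapForm r j s c := by
  by_contra hn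
  have h0 : gapForm r j s c = 0 := le_antisymm (not_lt.mp hn) (by unfold gapForm; positivity)
  rw [gapForm] at h0
  have a1 : s * gramVec r j 0 - 2 * c * j 1 = 0 := by
    nlinarith [sq_nonneg (s * gramVec r j 0 - 2 * c * j 1),
      sq_nonneg (s * gramVec r j 1 - 2 * c * j 2), sq_nonneg (s * gramVec r j 2 - 2 * c * j 3)]
  have a2 : s * gramVec r j 1 - 2 * c * j 2 = 0 := by
    nlinarith [sq_nonneg (s * gramVec r j 0 - 2 * c * j 1),
      sq_nonneg (s * gramVec r j 1 - 2 * c * j 2), sq_nonneg (s * gramVec r j 2 - 2 * c * j 3)]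
  have a3 : s * gramVec r j 2 - 2 * c * j 3 = 0 := by
    nlinarith [sq_nonneg (s * gramVec r j 0 - 2 * c * j 1),
      sq_nonneg (s * gramVec r j 1 - 2 * c * j 2), sq_nonneg (s * gramVec r j 2 - 2 * c * j 3)]
  apply h
  rw [isStarNormal_pauli_iff]
  simp [gramVec] at a1 a2 a3
  have hw : s * ((r 2 * j 3 - r 3 * j 2) ^ 2 + (r 3 * j 1 - r 1 * j 3) ^ 2 +
      (r 1 * j 2 - r 2 * j 1) ^ 2) = 0 := by
    linear_combination -(r 2 * j 3 - r 3 * j 2) / 2 * a1 - (r 3 * j 1 - r 1 * j 3) / 2 * a2 -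
      (r 1 * j 2 - r 2 * j 1) / 2 * a3
  rcases eq_or_ne s 0 with hs | hs
  · subst hs
    have hc : c ≠ 0 := by simpa using hsc
    have j1 : j 1 = 0 := by simpa [hc] using a1
    have j2 : j 2 = 0 := by simpa [hc] using a2
    have j3 : j 3 = 0 := by simpa [hc] using a3
    simp [j1, j2, j3]
  · have hw' := (mul_eq_zero.mp hw).resolve_left hs
    refine ⟨?_, ?_, ?_⟩ <;>
      nlinarith [sq_nonneg (r 2 * j 3 - r 3 * j 2), sq_nonneg (r 3 * j 1 - r 1 * j 3),
        sq_nonneg (r 1 * j 2 - r 2 * j 1)]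

/-- If `B` is normal, then `r × j = 0`, so that `G = 2 (r₀ r + j₀ j)` and `j` are linearly
dependent. -/
theorem exists_gapForm_eq_zero {r j : Fin 4 → ℝ} (h : IsStarNormal (pauli r j)) :
    ∃ s c : ℝ, (s ≠ 0 ∨ c ≠ 0) ∧ gapForm r j s c = 0 := by
  rw [isStarNormal_pauli_iff] at h
  obtain ⟨h1, h2, h3⟩ := h
  by_cases hj : j 1 ^ 2 + j 2 ^ 2 + j 3 ^ 2 = 0
  · refine ⟨0, 1, by simp, ?_⟩
    rw [gapForm]
    linear_combination 4 * hj
  · refine ⟨j 1 ^ 2 + j 2 ^ 2 + j 3 ^ 2,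
      r 0 * (r 1 * j 1 + r 2 * j 2 + r 3 * j 3) + j 0 * (j 1 ^ 2 + j 2 ^ 2 + j 3 ^ 2),
      Or.inl hj, ?_⟩
    have e : gramVec r j = ![2 * (r 0 * r 1 + j 0 * j 1), 2 * (r 0 * r 2 + j 0 * j 2),
        2 * (r 0 * r 3 + j 0 * j 3)] := by
      simp [gramVec, h1, h2, h3]
    rw [gapForm, e]
    simp only [Matrix.cons_val]
    have f1 : (j 1 ^ 2 + j 2 ^ 2 + j 3 ^ 2) * (2 * (r 0 * r 1 + j 0 * j 1)) -
        2 * (r 0 * (r 1 * j 1 + r 2 * j 2 + r 3 * j 3) + j 0 * (j 1 ^ 2 + j 2 ^ 2 + j 3 ^ 2)) * j 1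
        = 0 := by linear_combination 2 * r 0 * (j 2 * h3 - j 3 * h2)
    have f2 : (j 1 ^ 2 + j 2 ^ 2 + j 3 ^ 2) * (2 * (r 0 * r 2 + j 0 * j 2)) -
        2 * (r 0 * (r 1 * j 1 + r 2 * j 2 + r 3 * j 3) + j 0 * (j 1 ^ 2 + j 2 ^ 2 + j 3 ^ 2)) * j 2
        = 0 := by linear_combination 2 * r 0 * (j 3 * h1 - j 1 * h3)
    have f3 : (j 1 ^ 2 + j 2 ^ 2 + j 3 ^ 2) * (2 * (r 0 * r 3 + j 0 * j 3)) -
        2 * (r 0 * (r 1 * j 1 + r 2 * j 2 + r 3 * j 3) + j 0 * (j 1 ^ 2 + j 2 ^ 2 + j 3 ^ 2)) * j 3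
        = 0 := by linear_combination 2 * r 0 * (j 1 * h2 - j 2 * h1)
    rw [f1, f2, f3]
    ring

theorem exists_polar (x y : ℝ) :
    ∃ φ : ℝ, √(x ^ 2 + y ^ 2) * Real.cos φ = x ∧ √(x ^ 2 + y ^ 2) * Real.sin φ = y := by
  have hn : ‖(⟨x, y⟩ : ℂ)‖ = √(x ^ 2 + y ^ 2) := by
    rw [Complex.norm_def, Complex.normSq_apply]; simp [sq]
  rw [← hn]
  exact ⟨Complex.arg ⟨x, y⟩, Complex.norm_mul_cos_arg _, Complex.norm_mul_sin_arg _⟩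

theorem sqrt_lt_of_forall_lt {x y z : ℝ}
    (h : ∀ θ : ℝ, x * Real.cos (2 * θ) + y * Real.sin (2 * θ) - z < 0) :
    √(x ^ 2 + y ^ 2) < z := by
  obtain ⟨φ, hx, hy⟩ := exists_polar x y
  have h1 := h (φ / 2)
  rw [mul_div_cancel₀ _ two_ne_zero] at h1
  have e : x * Real.cos φ + y * Real.sin φ = √(x ^ 2 + y ^ 2) := by
    linear_combination (-Real.cos φ) * hx - Real.sin φ * hy +
      √(x ^ 2 + y ^ 2) * Real.sin_sq_add_cos_sq φ
  linarith

open Polynomial in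
theorem nrPoly_factorization {α : ℂ} {r j : Fin 4 → ℝ} {β₁ β₂ : ℝ}
    (hβ₁ : β₁ + β₂ = 2 * j 0) (hβ₂ : (β₁ - β₂) ^ 2 = 4 * (j 1 ^ 2 + j 2 ^ 2 + j 3 ^ 2))
    (hn : ¬ IsStarNormal (pauli r j)) (hs : SpectralCondition α (pauli r j) β₁ β₂)
    {p x y z : ℝ}
    (hp : p = |β₁ - β₂| / (2 * √(1 + α.im ^ 2)))
    (hx : x = ((∑ i, ∑ k, ‖pauli r j i k‖ ^ 2) - 2) / 4 + (α ^ 2).re / 2 - p ^ 2 / 2)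
    (hy : y = (β₁ + β₂) / 2 + (α ^ 2).im / 2)
    (hz : z = ((∑ i, ∑ k, ‖pauli r j i k‖ ^ 2) + 2) / 4 + ‖α‖ ^ 2 / 2 - p ^ 2 / 2) :
    0 < p ∧ √(x ^ 2 + y ^ 2) < z ∧
      ∀ θ : ℝ, nrPoly (blockMat α (pauli r j)) θ =
        ((X + C ((p * Real.sin θ : ℝ) : ℂ)) ^ 2 +
            C ((x * Real.cos (2 * θ) + y * Real.sin (2 * θ) - z : ℝ) : ℂ)) *
          ((X - C ((p * Real.sin θ : ℝ) : ℂ)) ^ 2 +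
            C ((x * Real.cos (2 * θ) + y * Real.sin (2 * θ) - z : ℝ) : ℂ)) := by
  have hv : 0 < 1 + α.im ^ 2 := by positivity
  have hP : p ^ 2 * (1 + α.im ^ 2) = j 1 ^ 2 + j 2 ^ 2 + j 3 ^ 2 := by
    rw [hp, div_pow, mul_pow, Real.sq_sqrt hv.le, sq_abs, hβ₂]
    field_simp
    ring
  rw [spectralCondition_iff α hβ₂ hP] at hs
  have hj : 0 < j 1 ^ 2 + j 2 ^ 2 + j 3 ^ 2 := by
    have := gapForm_pos hn (s := 0) (c := 1) (by simp)
    rw [gapForm] at this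
    linarith
  have hp0 : 0 < p := by
    have : 0 ≤ p := by rw [hp]; positivity
    refine this.lt_of_ne fun h0 => ?_
    rw [← h0] at hP
    linarith
  have hΩ : ∀ θ, x * Real.cos (2 * θ) + y * Real.sin (2 * θ) - z =
      -(meanForm α r j (Real.sin θ) (Real.cos θ) - p ^ 2 * Real.sin θ ^ 2) := by
    intro θ
    rw [hx, hy, hz, sum_norm_sq_pauli, hβ₁, Complex.sq_norm, Complex.normSq_apply,
      Real.cos_two_mul', Real.sin_two_mul, meanForm]
    simp only [sq, Complex.mul_re, Complex.mul_im]
    linear_combination (normHalf r j / 2 + 1 / 2 + (α.re ^ 2 + α.im ^ 2) / 2 - p ^ 2 / 2) *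
      Real.sin_sq_add_cos_sq θ
  refine ⟨hp0, sqrt_lt_of_forall_lt fun θ => ?_, fun θ => ?_⟩
  · rw [hΩ]
    have h1 : 0 < gapForm r j (Real.sin θ) (Real.cos θ) := by
      apply gapForm_pos hn
      by_contra! h
      have := Real.sin_sq_add_cos_sq θ
      rw [h.1, h.2] at this
      norm_num at this
    rw [hs] at h1
    have := pos_of_mul_pos_right h1 (by positivity)
    linarith
  · rw [nrPoly_blockMat, hΩ, hs]
    generalize meanForm α r j (Real.sin θ) (Real.cos θ) = T
    generalize Real.sin θ = s
    simp only [Complex.ofReal_mul, Complex.ofReal_sub, Complex.ofReal_pow, Complex.ofReal_ofNat,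
      Complex.ofReal_neg, C_mul, C_sub, C_pow, C_neg]
    rw [show (C (2 : ℂ)) = 2 from rfl, show (C (4 : ℂ)) = 4 from rfl]
    ring

/-! ### Numerical ranges: convexity and support function -/

section Convexity
variable {E : Type*} [NormedAddCommGroup E] [InnerProductSpace ℂ E]

/-- The main step in the Toeplitz–Hausdorff theorem: a numerical range that contains `0` and `1`
contains the interval between them. -/
theorem exists_unit_inner_apply_eq_ofReal (T : E →ₗ[ℂ] E) {x y : E} (hx : ‖x‖ = 1)
    (hy : ‖y‖ = 1) (h0 : inner ℂ x (T x) = 0) (h1 : inner ℂ y (T y) = 1) {s : ℝ}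
    (hs : s ∈ Set.Icc (0 : ℝ) 1) : ∃ z : E, ‖z‖ = 1 ∧ inner ℂ z (T z) = (s : ℂ) := by
  -- The phase `η` makes the quadratic form real on the real segment from `η x` to `y`.
  obtain ⟨η, hη, m, hm⟩ : ∃ η : ℂ, ‖η‖ = 1 ∧ ∃ m : ℝ,
      star η * inner ℂ x (T y) + η * inner ℂ y (T x) = (m : ℂ) := by
    generalize inner ℂ x (T y) = c
    generalize inner ℂ y (T x) = d
    refine ⟨Complex.exp ((-(Complex.arg (d - star c)) : ℝ) * Complex.I),
      Complex.norm_exp_ofReal_mul_I _, ?_⟩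
    set η := Complex.exp ((-(Complex.arg (d - star c)) : ℝ) * Complex.I) with hη
    have h : η * (d - star c) = (‖d - star c‖ : ℂ) := by
      conv_lhs => rw [← Complex.norm_mul_exp_arg_mul_I (d - star c)]
      rw [hη, mul_left_comm, ← Complex.exp_add]
      simp
    refine ⟨(star η * c + η * d).re, (Complex.conj_eq_iff_re.mp ?_).symm⟩
    have h' := congrArg (starRingEnd ℂ) h
    simp only [map_mul, map_sub, Complex.conj_ofReal, Complex.star_def, Complex.conj_conj,
      map_add] at h h' ⊢
    linear_combination h' - h
  let z : ℝ → E := fun t => ((1 - t : ℝ) : ℂ) • η • x + (t : ℂ) • y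
  have hQ : ∀ t : ℝ, inner ℂ (z t) (T (z t)) = ((t ^ 2 + t * (1 - t) * m : ℝ) : ℂ) := by
    intro t
    simp only [z, map_add, map_smul, inner_add_left, inner_add_right, inner_smul_left,
      inner_smul_right, h0, h1, Complex.conj_ofReal]
    simp only [Complex.star_def] at hm
    push_cast
    linear_combination (1 - t : ℂ) * t * hm
  have hz : ∀ t, z t ≠ 0 := by
    intro t ht
    have hq := hQ t
    have e : (t : ℂ) • y = -(((1 - t : ℝ) : ℂ) • η • x) := by
      rw [eq_neg_iff_add_eq_zero, add_comm]; exact ht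
    have hq : ((t ^ 2 : ℝ) : ℂ) = 0 := by
      have : inner ℂ ((t : ℂ) • y) (T ((t : ℂ) • y)) =
          inner ℂ (-(((1 - t : ℝ) : ℂ) • η • x)) (T (-(((1 - t : ℝ) : ℂ) • η • x))) := by rw [e]
      simp only [map_neg, map_smul, inner_neg_left, inner_neg_right, inner_smul_left,
        inner_smul_right, h0, h1, Complex.conj_ofReal] at this
      push_cast
      linear_combination this
    have ht0 : t = 0 := by
      have : t ^ 2 = 0 := by exact_mod_cast hq
      simpa using this
    have := congrArg norm e
    rw [ht0] at this
    simp [norm_smul, hη, hx] at this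
  have hcont : Continuous fun t : ℝ => (t ^ 2 + t * (1 - t) * m) / ‖z t‖ ^ 2 := by
    refine Continuous.div (by fun_prop) (by fun_prop) fun t => ?_
    exact pow_ne_zero _ (norm_ne_zero_iff.mpr (hz t))
  have := intermediate_value_Icc (zero_le_one (α := ℝ)) hcont.continuousOn
  have hs' : s ∈ Set.Icc (((0 : ℝ) ^ 2 + 0 * (1 - 0) * m) / ‖z 0‖ ^ 2)
      (((1 : ℝ) ^ 2 + 1 * (1 - 1) * m) / ‖z 1‖ ^ 2) := by
    simpa [z, hy] using hs
  obtain ⟨t, -, ht⟩ := this hs'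
  have hn : (‖z t‖ : ℂ) ≠ 0 := by exact_mod_cast norm_ne_zero_iff.mpr (hz t)
  refine ⟨((‖z t‖⁻¹ : ℝ) : ℂ) • z t, ?_, ?_⟩
  · rw [norm_smul, Complex.norm_real, norm_inv, norm_norm,
      inv_mul_cancel₀ (norm_ne_zero_iff.mpr (hz t))]
  · rw [map_smul, inner_smul_left, inner_smul_right, hQ, ← ht, Complex.conj_ofReal]
    push_cast
    field_simp

/-- The **Toeplitz–Hausdorff theorem**. -/
theorem convex_setOf_inner_apply (T : E →ₗ[ℂ] E) :
    Convex ℝ {w : ℂ | ∃ x : E, ‖x‖ = 1 ∧ w = inner ℂ x (T x)} := by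
  rintro _ ⟨x, hx, rfl⟩ _ ⟨y, hy, rfl⟩ p q hp hq hpq
  set a := inner ℂ x (T x) with ha
  set b := inner ℂ y (T y) with hb
  rcases eq_or_ne a b with hab | hab
  · refine ⟨x, hx, ?_⟩
    rw [← hab, ← add_smul, hpq, one_smul]
  have hba : b - a ≠ 0 := sub_ne_zero.mpr hab.symm
  let T' : E →ₗ[ℂ] E := (b - a)⁻¹ • (T - a • LinearMap.id)
  have hS : ∀ z : E, ‖z‖ = 1 → inner ℂ z (T' z) =
      (b - a)⁻¹ * (inner ℂ z (T z) - a) := by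
    intro z hz
    simp only [T', LinearMap.smul_apply, LinearMap.sub_apply, LinearMap.id_apply,
      inner_smul_right, inner_sub_right, inner_self_eq_norm_sq_to_K, hz]
    simp
  obtain ⟨z, hz, h⟩ := exists_unit_inner_apply_eq_ofReal T' hx hy
    (by rw [hS x hx]; simp [ha]) (by rw [hS y hy, ← hb, inv_mul_cancel₀ hba])
    (s := q) ⟨hq, by linarith⟩
  refine ⟨z, hz, ?_⟩
  rw [hS z hz, inv_mul_eq_iff_eq_mul₀ hba] at h
  have : (p : ℂ) = 1 - q := by rw [eq_sub_iff_add_eq]; exact_mod_cast hpq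
  rw [Complex.real_smul, Complex.real_smul, this]
  linear_combination -h
end Convexity

/-- `imRot θ w = Im (e^{-iθ} w)`. For fixed `w` these are the values at `w` of all real linear
functionals of norm one; the support function of a set `S` is `θ ↦ max (imRot θ '' S)`. -/
noncomputable def imRot (θ : ℝ) (w : ℂ) : ℝ := Real.cos θ * w.im - Real.sin θ * w.re

section NumericalRange
variable {n : Type*} [Fintype n] [DecidableEq n]

theorem convex_numericalRange (A : Matrix n n ℂ) : Convex ℝ (numericalRange A) :=
  convex_setOf_inner_apply _

theorem isCompact_numericalRange (A : Matrix n n ℂ) : IsCompact (numericalRange A) := by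
  have : numericalRange A = (fun x : EuclideanSpace ℂ n => inner ℂ x (Matrix.toEuclideanLin A x)) ''
      Metric.sphere 0 1 := by
    ext w
    simp [numericalRange, eq_comm]
  rw [this]
  refine (isCompact_sphere _ _).image ?_
  exact continuous_id.inner (LinearMap.continuous_of_finiteDimensional _)

theorem inner_imaginaryPart (M : Matrix n n ℂ) (x : EuclideanSpace ℂ n) :
    inner ℂ x (Matrix.toEuclideanLin (ℑ M : Matrix n n ℂ) x) =
      ((inner ℂ x (Matrix.toEuclideanLin M x)).im : ℂ) := by
  have h : (ℑ M : Matrix n n ℂ) = (-Complex.I / 2) • (M - Mᴴ) := by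
    ext i k
    rw [imaginaryPart_matrix]
    simp
    ring
  rw [h, map_smul, map_sub, Matrix.toEuclideanLin_conjTranspose_eq_adjoint, LinearMap.smul_apply,
    LinearMap.sub_apply, inner_smul_right, inner_sub_right, LinearMap.adjoint_inner_right,
    ← inner_conj_symm (Matrix.toEuclideanLin M x) x]
  generalize inner ℂ x (Matrix.toEuclideanLin M x) = w
  apply Complex.ext <;> simp
  ring

theorem inner_imaginaryPart_exp_smul (A : Matrix n n ℂ) (θ : ℝ) (x : EuclideanSpace ℂ n) :
    inner ℂ x (Matrix.toEuclideanLin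
      (ℑ (Complex.exp (-(Complex.I * θ)) • A) : Matrix n n ℂ) x) =
      (imRot θ (inner ℂ x (Matrix.toEuclideanLin A x)) : ℂ) := by
  rw [inner_imaginaryPart, map_smul, LinearMap.smul_apply, inner_smul_right, exp_neg_I_mul, imRot,
    Complex.mul_im]
  congr 1
  ring

theorem nrPoly_isRoot_iff (A : Matrix n n ℂ) (θ μ : ℝ) :
    (nrPoly A θ).IsRoot (μ : ℂ) ↔ Module.End.HasEigenvalue (Matrix.toEuclideanLin
      (ℑ (Complex.exp (-(Complex.I * θ)) • A) : Matrix n n ℂ)) (μ : ℂ) := by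
  rw [Module.End.hasEigenvalue_iff_isRoot_charpoly, nrPoly,
    ← LinearMap.charpoly_toMatrix _ (EuclideanSpace.basisFun n ℂ).toBasis,
    Matrix.toEuclideanLin_eq_toLin_orthonormal, LinearMap.toMatrix_toLin]

/-- The support function of the numerical range of `A` at `θ` is the largest eigenvalue of
`Im (e^{-iθ} A)`, that is, the largest root of the NR generating polynomial. -/
theorem isGreatest_imRot_iff [Nonempty n] (A : Matrix n n ℂ) (θ μ : ℝ) :
    IsGreatest (imRot θ '' numericalRange A) μ ↔
      IsGreatest {ν : ℝ | (nrPoly A θ).IsRoot (ν : ℂ)} μ := by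
  set H := (ℑ (Complex.exp (-(Complex.I * θ)) • A) : Matrix n n ℂ) with hH
  have hsub : {ν : ℝ | (nrPoly A θ).IsRoot (ν : ℂ)} ⊆ imRot θ '' numericalRange A := by
    intro ν hν
    rw [Set.mem_ofPred_eq, nrPoly_isRoot_iff] at hν
    obtain ⟨x, hx⟩ := hν.exists_hasEigenvector
    have hx0 := hx.2
    have hn : (‖x‖ : ℂ) ≠ 0 := by exact_mod_cast norm_ne_zero_iff.mpr hx0
    set y : EuclideanSpace ℂ n := ((‖x‖ : ℂ)⁻¹) • x with hy
    have hy1 : ‖y‖ = 1 := by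
      rw [hy, norm_smul, norm_inv, Complex.norm_real, norm_norm,
        inv_mul_cancel₀ (norm_ne_zero_iff.mpr hx0)]
    refine ⟨_, ⟨y, hy1, rfl⟩, ?_⟩
    have h1 := inner_imaginaryPart_exp_smul A θ y
    rw [hy, map_smul, hx.apply_eq_smul, smul_comm, ← hy, inner_smul_right,
      inner_self_eq_norm_sq_to_K, hy1] at h1
    simp at h1
    exact_mod_cast h1.symm
  have hroot : ∀ μ, IsGreatest (imRot θ '' numericalRange A) μ → (nrPoly A θ).IsRoot (μ : ℂ) := by
    rintro μ ⟨⟨_, ⟨x, hx, rfl⟩, rfl⟩, hmax⟩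
    have hsymm : (Matrix.toEuclideanLin H).IsSymmetric :=
      Matrix.isSymmetric_toEuclideanLin_iff.mpr (ℑ (Complex.exp (-(Complex.I * θ)) • A)).2
    have hval : ∀ z : EuclideanSpace ℂ n, (hsymm.toSelfAdjoint.val).reApplyInnerSelf z =
        imRot θ (inner ℂ z (Matrix.toEuclideanLin A z)) := by
      intro z
      have := inner_imaginaryPart_exp_smul A θ z
      rw [ContinuousLinearMap.reApplyInnerSelf_apply, ← inner_conj_symm]
      change RCLike.re (starRingEnd ℂ (inner ℂ z (Matrix.toEuclideanLin H z))) = _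
      rw [this]
      simp
    have hx0 : x ≠ 0 := by rintro rfl; simp at hx
    have hm : IsMaxOn (hsymm.toSelfAdjoint.val).reApplyInnerSelf (Metric.sphere 0 ‖x‖) x := by
      intro z hz
      have hz1 : ‖z‖ = 1 := by rw [← hx]; simpa using hz
      simp only [Set.mem_ofPred_eq, hval]
      exact hmax ⟨_, ⟨z, hz1, rfl⟩, rfl⟩
    have := hsymm.toSelfAdjoint.prop.eq_smul_self_of_isLocalExtrOn (x₀ := x) (Or.inr hm.localize)
    rw [nrPoly_isRoot_iff]
    refine Module.End.hasEigenvalue_of_hasEigenvector (x := x)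
      ⟨Module.End.mem_eigenspace_iff.mpr ?_, hx0⟩
    rw [ContinuousLinearMap.rayleighQuotient, hval, hx] at this
    refine Eq.trans (show Matrix.toEuclideanLin H x = _ from this) ?_
    simp
  have hex : ∃ m, IsGreatest (imRot θ '' numericalRange A) m := by
    refine IsCompact.exists_isGreatest ((isCompact_numericalRange A).image ?_) ?_
    · unfold imRot; fun_prop
    · obtain ⟨x, hx⟩ := exists_norm_eq (EuclideanSpace ℂ n) (zero_le_one (α := ℝ))
      exact ⟨_, _, ⟨x, hx, rfl⟩, rfl⟩
  constructor
  · intro h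
    exact ⟨hroot μ h, fun ν hν => h.2 (hsub hν)⟩
  · intro h
    obtain ⟨m, hm⟩ := hex
    have : m = μ := IsGreatest.unique ⟨hroot m hm, fun ν hν => hm.2 (hsub hν)⟩ h
    rwa [← this]
end NumericalRange

/-! ### Support functions of plane convex sets and of ellipses -/

theorem imRot_add (θ : ℝ) (w w' : ℂ) : imRot θ (w + w') = imRot θ w + imRot θ w' := by
  simp [imRot]; ring

theorem imRot_add_pi (θ : ℝ) (w : ℂ) : imRot (θ + Real.pi) w = -imRot θ w := by
  simp [imRot]; ring

theorem isLinearMap_imRot (θ : ℝ) : IsLinearMap ℝ (imRot θ) :=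
  ⟨imRot_add θ, fun r w => by simp [imRot]; ring⟩

/-- Passing to the convex hull does not change the support function. -/
theorem isGreatest_imRot_convexHull {θ : ℝ} {S : Set ℂ} {μ : ℝ}
    (h : IsGreatest (imRot θ '' S) μ) : IsGreatest (imRot θ '' convexHull ℝ S) μ := by
  refine ⟨Set.image_mono (subset_convexHull ℝ S) h.1, ?_⟩
  have : convexHull ℝ S ⊆ {w | imRot θ w ≤ μ} :=
    convexHull_min (fun w hw => h.2 ⟨w, hw, rfl⟩) (convex_halfSpace_le (isLinearMap_imRot θ) μ)
  rintro _ ⟨w, hw, rfl⟩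
  exact this hw

/-- Strict separation of a point from a closed convex set in the plane, the separating real
functional being written as a positive multiple of some `imRot θ`. -/
theorem exists_forall_imRot_lt {K : Set ℂ} (hK : IsClosed K) (hc : Convex ℝ K) {w : ℂ}
    (hw : w ∉ K) : ∃ θ : ℝ, ∀ k ∈ K, imRot θ k < imRot θ w := by
  obtain ⟨f, u, hf, hu⟩ := geometric_hahn_banach_closed_point hc hK hw
  obtain ⟨θ, h1, h2⟩ := exists_polar (f Complex.I) (-f 1)
  have hlin : ∀ y : ℂ, f y = √(f Complex.I ^ 2 + (-f 1) ^ 2) * imRot θ y := by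
    intro y
    have hy : y = y.re • (1 : ℂ) + y.im • Complex.I := by
      simp [Complex.re_add_im]
    have h3 : f y = y.re * f 1 + y.im * f Complex.I := by
      conv_lhs => rw [hy]
      simp only [map_add, map_smul, smul_eq_mul]
    rw [h3, imRot]
    linear_combination (-y.im) * h1 + y.re * h2
  refine ⟨θ, fun k hk => ?_⟩
  have := (hf k hk).trans hu
  rw [hlin k, hlin w] at this
  exact lt_of_mul_lt_mul_left this (Real.sqrt_nonneg _)

theorem subset_of_isGreatest_imRot {K L : Set ℂ} (hL : IsCompact L) (hLc : Convex ℝ L)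
    (h : ∀ θ, ∃ μ, IsGreatest (imRot θ '' K) μ ∧ IsGreatest (imRot θ '' L) μ) : K ⊆ L := by
  intro w hw
  by_contra hn
  obtain ⟨θ, hθ⟩ := exists_forall_imRot_lt hL.isClosed hLc hn
  obtain ⟨μ, h1, ⟨y, hy, rfl⟩, -⟩ := h θ
  exact absurd (h1.2 ⟨w, hw, rfl⟩) (not_le.mpr (hθ y hy))

theorem isGreatest_range_cos_sin (M N : ℝ) :
    IsGreatest (Set.range fun t : ℝ => M * Real.cos t + N * Real.sin t) √(M ^ 2 + N ^ 2) := by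
  constructor
  · obtain ⟨φ, hx, hy⟩ := exists_polar M N
    refine ⟨φ, ?_⟩
    dsimp only
    linear_combination (-Real.cos φ) * hx - Real.sin φ * hy +
      √(M ^ 2 + N ^ 2) * Real.sin_sq_add_cos_sq φ
  · rintro _ ⟨t, rfl⟩
    apply Real.le_sqrt_of_sq_le
    nlinarith [sq_nonneg (M * Real.sin t - N * Real.cos t), Real.sin_sq_add_cos_sq t]

theorem isGreatest_imRot_ellipse (c : ℂ) (a b φ θ : ℝ) :
    IsGreatest (imRot θ '' Set.range fun t : ℝ =>
      c + Complex.exp (φ * Complex.I) * ((a * Real.cos t : ℝ) + (b * Real.sin t : ℝ) * Complex.I))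
      (imRot θ c + √((a * Real.sin (φ - θ)) ^ 2 + (b * Real.cos (φ - θ)) ^ 2)) := by
  have := isGreatest_range_cos_sin (a * Real.sin (φ - θ)) (b * Real.cos (φ - θ))
  have he : (imRot θ '' Set.range fun t : ℝ =>
      c + Complex.exp (φ * Complex.I) * ((a * Real.cos t : ℝ) + (b * Real.sin t : ℝ) * Complex.I)) =
      (fun y => imRot θ c + y) '' (Set.range fun t : ℝ => a * Real.sin (φ - θ) * Real.cos t +
        b * Real.cos (φ - θ) * Real.sin t) := by
    rw [← Set.range_comp, ← Set.range_comp]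
    congr 1
    ext t
    simp only [Function.comp, imRot_add]
    congr 1
    rw [imRot, Real.sin_sub, Real.cos_sub, Complex.exp_mul_I, ← Complex.ofReal_cos,
      ← Complex.ofReal_sin, Complex.mul_re, Complex.mul_im]
    simp only [Complex.add_re, Complex.add_im, Complex.ofReal_re, Complex.ofReal_im,
      Complex.re_ofReal_mul, Complex.im_ofReal_mul, Complex.I_re, Complex.I_im]
    ring
  rw [he]
  exact Monotone.map_isGreatest (fun x y h => by simpa using h) this

open scoped Pointwise in
/-- The convex hull of an ellipse is the image of the closed unit disk under the affine map that
sends the unit circle to the ellipse. -/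
theorem IsEllipse.isCompact_convexHull {E : Set ℂ} {c : ℂ} (h : IsEllipse E c) :
    IsCompact (convexHull ℝ E) := by
  obtain ⟨a, b, φ, -, -, rfl⟩ := h
  let L : ℂ →ₗ[ℝ] ℂ :=
    { toFun := fun z => Complex.exp (φ * Complex.I) * ((a * z.re : ℝ) + (b * z.im : ℝ) * Complex.I)
      map_add' := fun z w => by simp; ring
      map_smul' := fun r z => by simp; ring }
  have hE : (Set.range fun t : ℝ => c + Complex.exp (φ * Complex.I) *
      ((a * Real.cos t : ℝ) + (b * Real.sin t : ℝ) * Complex.I)) =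
      ({c} : Set ℂ) + L '' Metric.sphere (0 : ℂ) 1 := by
    ext w
    simp only [Set.singleton_add, Set.mem_image, Set.mem_range]
    constructor
    · rintro ⟨t, rfl⟩
      refine ⟨_, ⟨Complex.exp (t * Complex.I), ?_, rfl⟩, ?_⟩
      · simp [Complex.norm_exp_ofReal_mul_I]
      · simp only [L, LinearMap.coe_mk, AddHom.coe_mk, Complex.exp_ofReal_mul_I_re,
          Complex.exp_ofReal_mul_I_im]
    · rintro ⟨_, ⟨ζ, hζ, rfl⟩, rfl⟩
      have hn : ‖ζ‖ = 1 := by simpa using hζ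
      refine ⟨Complex.arg ζ, ?_⟩
      have h1 := Complex.norm_mul_cos_arg ζ
      have h2 := Complex.norm_mul_sin_arg ζ
      rw [hn, one_mul] at h1 h2
      simp only [L, LinearMap.coe_mk, AddHom.coe_mk, h1, h2]
  rw [hE, convexHull_add, convexHull_singleton, ← L.image_convexHull,
    convexHull_sphere_eq_closedBall _ zero_le_one]
  exact isCompact_singleton.add
    ((isCompact_closedBall _ _).image L.continuous_of_finiteDimensional)

theorem isCompact_convexHull_union {S T : Set ℂ} (hS : IsCompact (convexHull ℝ S))
    (hT : IsCompact (convexHull ℝ T)) (hS0 : S.Nonempty) (hT0 : T.Nonempty) :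
    IsCompact (convexHull ℝ (S ∪ T)) := by
  rw [convexHull_union hS0 hT0]
  have : convexJoin ℝ (convexHull ℝ S) (convexHull ℝ T) =
      (fun x : ℝ × ℂ × ℂ => (1 - x.1) • x.2.1 + x.1 • x.2.2) ''
        (Set.Icc 0 1 ×ˢ convexHull ℝ S ×ˢ convexHull ℝ T) := by
    ext w
    simp only [mem_convexJoin, segment_eq_image, Set.mem_image, Set.mem_prod, Prod.exists]
    constructor
    · rintro ⟨x, hx, y, hy, t, ht, rfl⟩
      exact ⟨t, x, y, ⟨ht, hx, hy⟩, rfl⟩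
    · rintro ⟨t, x, y, ⟨ht, hx, hy⟩, rfl⟩
      exact ⟨x, hx, y, hy, t, ht, rfl⟩
  rw [this]
  exact (isCompact_Icc.prod (hS.prod hT)).image (by fun_prop)

theorem IsEllipse.nonempty {E : Set ℂ} {c : ℂ} (h : IsEllipse E c) : E.Nonempty := by
  obtain ⟨a, b, φ, -, -, rfl⟩ := h
  exact Set.range_nonempty _

/-- An ellipse with center `c` has a support function of the form `ℓ + √q`, where
`ℓ(θ) = Im (e^{-iθ} c)` and `q` is positive, analytic (`ContDiff` of order `⊤ = ω`) and
`π`-periodic. -/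
theorem IsEllipse.exists_support {E : Set ℂ} {c : ℂ} (h : IsEllipse E c) :
    ∃ q : ℝ → ℝ, (∀ θ, 0 < q θ) ∧ (∀ θ, q (θ + Real.pi) = q θ) ∧
      ContDiff ℝ ⊤ q ∧
      ∀ θ, IsGreatest (imRot θ '' E) (imRot θ c + √(q θ)) := by
  obtain ⟨a, b, φ, ha, hb, rfl⟩ := h
  refine ⟨fun θ => (a * Real.sin (φ - θ)) ^ 2 + (b * Real.cos (φ - θ)) ^ 2, fun θ => ?_,
    fun θ => ?_, ?_, fun θ => isGreatest_imRot_ellipse c a b φ θ⟩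
  · have h1 := Real.sin_sq_add_cos_sq (φ - θ)
    by_contra! hn
    have h2 : a * Real.sin (φ - θ) = 0 := by
      nlinarith [sq_nonneg (a * Real.sin (φ - θ)), sq_nonneg (b * Real.cos (φ - θ))]
    have h3 : b * Real.cos (φ - θ) = 0 := by
      nlinarith [sq_nonneg (a * Real.sin (φ - θ)), sq_nonneg (b * Real.cos (φ - θ))]
    rw [(mul_eq_zero.mp h2).resolve_left ha.ne', (mul_eq_zero.mp h3).resolve_left hb.ne'] at h1
    norm_num at h1
  · simp only [← sub_sub, Real.sin_sub_pi, Real.cos_sub_pi]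
    ring
  · fun_prop

/-- The ellipse with center `c`, squared semi-axes `z ± √(x² + y²)` and rotation angle half the
argument of `x + iy` has the support function `ℓ + √(z - x cos 2θ - y sin 2θ)`. -/
theorem exists_isEllipse {x y z : ℝ} (h : √(x ^ 2 + y ^ 2) < z) (c : ℂ) :
    ∃ E, IsEllipse E c ∧ ∀ θ, IsGreatest (imRot θ '' E)
      (imRot θ c + √(z - x * Real.cos (2 * θ) - y * Real.sin (2 * θ))) := by
  set R := √(x ^ 2 + y ^ 2) with hR
  have hR0 : 0 ≤ R := Real.sqrt_nonneg _
  obtain ⟨ψ, hx, hy⟩ := exists_polar x y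
  rw [← hR] at hx hy
  obtain ⟨φ, hφ⟩ : ∃ φ, 2 * φ = ψ := ⟨ψ / 2, by ring⟩
  rw [← hφ] at hx hy
  refine ⟨_, ⟨√(z + R), √(z - R), φ, Real.sqrt_pos.mpr (by linarith),
    Real.sqrt_pos.mpr (by linarith), rfl⟩, fun θ => ?_⟩
  have := isGreatest_imRot_ellipse c √(z + R) √(z - R) φ θ
  convert this using 3
  rw [mul_pow, mul_pow, Real.sq_sqrt (by linarith), Real.sq_sqrt (by linarith), ← hx, ← hy]
  have h1 : Real.cos (2 * φ) * Real.cos (2 * θ) + Real.sin (2 * φ) * Real.sin (2 * θ) =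
      Real.cos (φ - θ) ^ 2 - Real.sin (φ - θ) ^ 2 := by
    rw [← Real.cos_sub, ← mul_sub, Real.cos_two_mul']
  linear_combination -R * h1 - z * Real.sin_sq_add_cos_sq (φ - θ)

/-! ### Bi-elliptical numerical ranges -/

theorem nrPoly_blockMat_isRoot_iff (α : ℂ) (r j : Fin 4 → ℝ) (θ μ : ℝ) :
    (nrPoly (blockMat α (pauli r j)) θ).IsRoot (μ : ℂ) ↔
      (μ ^ 2 - meanForm α r j (Real.sin θ) (Real.cos θ)) ^ 2 =
        Real.sin θ ^ 2 * gapForm r j (Real.sin θ) (Real.cos θ) := by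
  rw [nrPoly_blockMat, Polynomial.IsRoot.def]
  simp only [Polynomial.eval_add, Polynomial.eval_sub, Polynomial.eval_mul, Polynomial.eval_pow,
    Polynomial.eval_X, Polynomial.eval_C]
  norm_cast
  constructor <;> intro h <;> linear_combination h

theorem gapForm_smul (r j : Fin 4 → ℝ) (ρ s c : ℝ) :
    gapForm r j (ρ * s) (ρ * c) = ρ ^ 2 * gapForm r j s c := by
  simp only [gapForm]; ring

theorem meanForm_smul (α : ℂ) (r j : Fin 4 → ℝ) (ρ s c : ℝ) :
    meanForm α r j (ρ * s) (ρ * c) = ρ ^ 2 * meanForm α r j s c := by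
  simp only [meanForm]; ring

theorem contDiff_root_defect {α : ℂ} {r j : Fin 4 → ℝ} {f : ℝ → ℝ} (hf : ContDiff ℝ ⊤ f) :
    ContDiff ℝ ⊤ fun θ => (f θ ^ 2 - meanForm α r j (Real.sin θ) (Real.cos θ)) ^ 2 -
      Real.sin θ ^ 2 * gapForm r j (Real.sin θ) (Real.cos θ) := by
  unfold meanForm gapForm
  have := Real.contDiff_sin (n := ⊤)
  have := Real.contDiff_cos (n := ⊤)
  fun_prop

/-- If `max (f θ) (g θ)` is a root of the NR generating polynomial for every `θ`, and the analytic
function `f` exceeds `g` at one point, then `f θ` is a root for every `θ`: this holds near that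
point, hence everywhere by the identity principle. -/
theorem root_of_root_max {α : ℂ} {r j : Fin 4 → ℝ} {f g : ℝ → ℝ}
    (hf : ContDiff ℝ ⊤ f) (hg : Continuous g)
    (h : ∀ θ, (max (f θ) (g θ) ^ 2 - meanForm α r j (Real.sin θ) (Real.cos θ)) ^ 2 =
      Real.sin θ ^ 2 * gapForm r j (Real.sin θ) (Real.cos θ))
    {θ₀ : ℝ} (hlt : g θ₀ < f θ₀) (θ : ℝ) :
    (f θ ^ 2 - meanForm α r j (Real.sin θ) (Real.cos θ)) ^ 2 =
      Real.sin θ ^ 2 * gapForm r j (Real.sin θ) (Real.cos θ) := by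
  have h0 : (fun θ => (f θ ^ 2 - meanForm α r j (Real.sin θ) (Real.cos θ)) ^ 2 -
      Real.sin θ ^ 2 * gapForm r j (Real.sin θ) (Real.cos θ)) = fun _ => 0 := by
    refine AnalyticOnNhd.eq_of_eventuallyEq (z₀ := θ₀) (contDiff_root_defect hf).analyticOnNhd
      analyticOnNhd_const ?_
    filter_upwards [hg.continuousAt.eventually_lt hf.continuous.continuousAt hlt] with t ht
    rw [sub_eq_zero, ← h t, max_eq_left ht.le]
  exact sub_eq_zero.mp (congrFun h0 θ)

theorem contDiff_support (c : ℂ) {q : ℝ → ℝ} (hq : ∀ θ, 0 < q θ)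
    (hs : ContDiff ℝ ⊤ q) : ContDiff ℝ ⊤ fun θ => imRot θ c + √(q θ) := by
  unfold imRot
  exact ((Real.contDiff_cos.mul contDiff_const).sub (Real.contDiff_sin.mul contDiff_const)).add
    (hs.sqrt fun θ => (hq θ).ne')

/-- If the support function `ℓ + √q` of an ellipse whose center `c` is not `0` consists of roots of
the NR generating polynomial, then `c` is real and the gap form is determined by the mean form.
Replacing `θ` by `θ + π` changes the sign of `ℓ` and nothing else, so `-ℓ + √q` is a root
as well; since only even powers of `λ` occur, all four roots `±ℓ ± √q` are known. -/
theorem gapForm_eq_of_root {α : ℂ} {r j : Fin 4 → ℝ} {c : ℂ} (hc : c ≠ 0) {q : ℝ → ℝ}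
    (hq : ∀ θ, 0 < q θ) (hper : ∀ θ, q (θ + Real.pi) = q θ)
    (h : ∀ θ, ((imRot θ c + √(q θ)) ^ 2 - meanForm α r j (Real.sin θ) (Real.cos θ)) ^ 2 =
      Real.sin θ ^ 2 * gapForm r j (Real.sin θ) (Real.cos θ)) :
    (∀ s d, gapForm r j s d = 4 * c.re ^ 2 * (meanForm α r j s d - c.re ^ 2 * s ^ 2)) ∧
      ¬ IsStarNormal (pauli r j) := by
  have hsym : ∀ θ, imRot θ c ≠ 0 →
      meanForm α r j (Real.sin θ) (Real.cos θ) = q θ + imRot θ c ^ 2 ∧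
      Real.sin θ ^ 2 * gapForm r j (Real.sin θ) (Real.cos θ) = 4 * imRot θ c ^ 2 * q θ := by
    intro θ hθ
    have h1 := h θ
    have h2 := h (θ + Real.pi)
    rw [imRot_add_pi, hper, Real.sin_add_pi, Real.cos_add_pi, ← neg_one_mul (Real.sin θ),
      ← neg_one_mul (Real.cos θ), meanForm_smul, gapForm_smul] at h2
    have hsq := Real.sq_sqrt (hq θ).le
    have hpos := Real.sqrt_pos.mpr (hq θ)
    generalize √(q θ) = m at h1 h2 hsq hpos
    have e : 8 * (imRot θ c * m) *
        (q θ + imRot θ c ^ 2 - meanForm α r j (Real.sin θ) (Real.cos θ)) = 0 := by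
      rw [← hsq]
      linear_combination h1 - h2
    have hT := (mul_eq_zero.mp e).resolve_left
      (mul_ne_zero (by norm_num) (mul_ne_zero hθ hpos.ne'))
    have hT' : meanForm α r j (Real.sin θ) (Real.cos θ) = q θ + imRot θ c ^ 2 := by linarith
    refine ⟨hT', ?_⟩
    rw [← h1, hT', ← hsq]
    ring
  -- At `θ = 0` the gap form enters with the factor `sin² θ = 0`, which forces `ℓ(0) = c.im` to vanish.
  have him : c.im = 0 := by
    by_contra hne
    have e : imRot 0 c = c.im := by simp [imRot]
    have := (hsym 0 (by rwa [e])).2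
    rw [e] at this
    have h0 : 0 < 4 * c.im ^ 2 * q 0 := by have := hq 0; positivity
    simp at this
    rcases this with h | h
    · exact hne h
    · exact (hq 0).ne' h
  have hre : c.re ≠ 0 := fun h0 => hc (Complex.ext h0 him)
  have hP : 0 < 4 * c.re ^ 2 := by positivity
  -- By homogeneity, the relations at the angles with `sin θ ≠ 0` hold at all pairs with `s ≠ 0`.
  have hoff : ∀ s d : ℝ, s ≠ 0 →
      gapForm r j s d = 4 * c.re ^ 2 * (meanForm α r j s d - c.re ^ 2 * s ^ 2) ∧
        0 < gapForm r j s d := by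
    intro s d hs
    obtain ⟨θ, hθ1, hθ2⟩ := exists_polar d s
    set ρ := √(d ^ 2 + s ^ 2)
    have hρ : ρ ≠ 0 := by rintro h0; rw [h0, zero_mul] at hθ2; exact hs hθ2.symm
    have hsin : Real.sin θ ≠ 0 := by rintro h0; rw [h0, mul_zero] at hθ2; exact hs hθ2.symm
    have hl : imRot θ c = -(Real.sin θ * c.re) := by simp [imRot, him]
    have hl0 : imRot θ c ≠ 0 := by rw [hl]; exact neg_ne_zero.mpr (mul_ne_zero hsin hre)
    obtain ⟨hT, hN⟩ := hsym θ hl0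
    have hN' : gapForm r j (Real.sin θ) (Real.cos θ) = 4 * c.re ^ 2 * q θ := by
      apply mul_left_cancel₀ (pow_ne_zero 2 hsin)
      rw [hN, hl]; ring
    rw [← hθ1, ← hθ2, gapForm_smul, meanForm_smul, hN', hT, hl]
    constructor
    · ring
    · have := hq θ
      positivity
  -- A binary quadratic form that vanishes at three independent pairs is `0`, so `s = 0` is covered.
  have hall : ∀ s d, gapForm r j s d = 4 * c.re ^ 2 * (meanForm α r j s d - c.re ^ 2 * s ^ 2) := by
    intro s d
    have h1 := (hoff 1 0 one_ne_zero).1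
    have h2 := (hoff 1 1 one_ne_zero).1
    have h3 := (hoff 1 (-1) one_ne_zero).1
    simp only [gapForm, meanForm] at h1 h2 h3 ⊢
    linear_combination (s ^ 2 - d ^ 2) * h1 + (d ^ 2 + s * d) / 2 * h2 + (d ^ 2 - s * d) / 2 * h3
  refine ⟨hall, fun hn => ?_⟩
  obtain ⟨s, d, hsd, h0⟩ := exists_gapForm_eq_zero hn
  rcases eq_or_ne s 0 with hs | hs
  · subst hs
    have hd : d ≠ 0 := by simpa using hsd
    rw [hall, meanForm] at h0
    have : 0 < 4 * c.re ^ 2 * (d ^ 2 * (1 + α.im ^ 2)) := by positivity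
    nlinarith
  · exact (hoff s d hs).2.ne' h0

theorem gapForm_eq_of_isBiElliptical {α : ℂ} {r j : Fin 4 → ℝ}
    (h : IsBiElliptical (numericalRange (blockMat α (pauli r j)))) :
    ∃ p : ℝ, (∀ s d, gapForm r j s d = 4 * p ^ 2 * (meanForm α r j s d - p ^ 2 * s ^ 2)) ∧
      ¬ IsStarNormal (pauli r j) := by
  obtain ⟨E₁, E₂, c₁, c₂, h₁, h₂, hc, hn₁, hn₂, hW⟩ := h
  obtain ⟨q₁, hq₁, hper₁, hs₁, hg₁⟩ := h₁.exists_support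
  obtain ⟨q₂, hq₂, hper₂, hs₂, hg₂⟩ := h₂.exists_support
  have hmax : ∀ θ, (max (imRot θ c₁ + √(q₁ θ)) (imRot θ c₂ + √(q₂ θ)) ^ 2 -
      meanForm α r j (Real.sin θ) (Real.cos θ)) ^ 2 =
      Real.sin θ ^ 2 * gapForm r j (Real.sin θ) (Real.cos θ) := by
    intro θ
    rw [← nrPoly_blockMat_isRoot_iff]
    refine ((isGreatest_imRot_iff (blockMat α (pauli r j)) θ _).mp ?_).1
    rw [hW]
    apply isGreatest_imRot_convexHull
    rw [Set.image_union]
    exact (hg₁ θ).union (hg₂ θ)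
  -- Neither ellipse is redundant, so each support function exceeds the other one somewhere.
  have hlt : ∀ {E E' : Set ℂ} {c' : ℂ} {h h' : ℝ → ℝ}, IsEllipse E' c' →
      (∀ θ, IsGreatest (imRot θ '' E) (h θ)) → (∀ θ, IsGreatest (imRot θ '' E') (h' θ)) →
      ¬ E ⊆ convexHull ℝ E' → ∃ θ, h' θ < h θ := by
    intro E E' c' h h' hE' hh hh' hn
    obtain ⟨w, hw, hw'⟩ := Set.not_subset.mp hn
    obtain ⟨θ, hθ⟩ := exists_forall_imRot_lt hE'.isCompact_convexHull.isClosed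
      (convex_convexHull ℝ E') hw'
    obtain ⟨k, hk, hk'⟩ := (hh' θ).1
    exact ⟨θ, hk' ▸ (hθ k (subset_convexHull ℝ E' hk)).trans_le ((hh θ).2 ⟨w, hw, rfl⟩)⟩
  have hd₁ := contDiff_support c₁ hq₁ hs₁
  have hd₂ := contDiff_support c₂ hq₂ hs₂
  -- The centers are distinct, so one of them is not `0`.
  by_cases h0 : c₁ = 0
  · obtain ⟨θ₀, hθ₀⟩ := hlt h₁ hg₂ hg₁ hn₂
    refine ⟨_, gapForm_eq_of_root (h0 ▸ hc.symm) hq₂ hper₂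
      (root_of_root_max hd₂ hd₁.continuous (fun θ => ?_) hθ₀)⟩
    rw [max_comm]
    exact hmax θ
  · obtain ⟨θ₀, hθ₀⟩ := hlt h₂ hg₁ hg₂ hn₁
    exact ⟨_, gapForm_eq_of_root h0 hq₁ hper₁
      (root_of_root_max hd₁ hd₂.continuous hmax hθ₀)⟩

open Polynomial in
/-- If the NR generating polynomial factors as stated, the numerical range is the convex hull of
two translates, with centers `±p`, of one ellipse centered at `0`: both compact convex sets have the
support function `p |sin θ| + √(-Ω(θ))`. -/
theorem isBiElliptical_of_nrPoly {n : Type*} [Fintype n] [DecidableEq n] [Nonempty n]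
    {A : Matrix n n ℂ} {p x y z : ℝ} (hp : 0 < p) (hz : √(x ^ 2 + y ^ 2) < z)
    (h : ∀ θ : ℝ, nrPoly A θ =
        ((X + C ((p * Real.sin θ : ℝ) : ℂ)) ^ 2 +
            C ((x * Real.cos (2 * θ) + y * Real.sin (2 * θ) - z : ℝ) : ℂ)) *
          ((X - C ((p * Real.sin θ : ℝ) : ℂ)) ^ 2 +
            C ((x * Real.cos (2 * θ) + y * Real.sin (2 * θ) - z : ℝ) : ℂ))) :
    IsBiElliptical (numericalRange A) := by
  obtain ⟨E₁, h₁, hg₁⟩ := exists_isEllipse hz ((-p : ℝ) : ℂ)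
  obtain ⟨E₂, h₂, hg₂⟩ := exists_isEllipse hz ((p : ℝ) : ℂ)
  have hc : ∀ θ t : ℝ, imRot θ (t : ℂ) = -(Real.sin θ * t) := by simp [imRot]
  have hunion : ∀ θ, IsGreatest (imRot θ '' convexHull ℝ (E₁ ∪ E₂))
      (max (imRot θ ((-p : ℝ) : ℂ) + √(z - x * Real.cos (2 * θ) - y * Real.sin (2 * θ)))
        (imRot θ ((p : ℝ) : ℂ) + √(z - x * Real.cos (2 * θ) - y * Real.sin (2 * θ)))) := by
    intro θ
    apply isGreatest_imRot_convexHull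
    rw [Set.image_union]
    exact (hg₁ θ).union (hg₂ θ)
  have hnr : ∀ θ, IsGreatest (imRot θ '' numericalRange A)
      (max (imRot θ ((-p : ℝ) : ℂ) + √(z - x * Real.cos (2 * θ) - y * Real.sin (2 * θ)))
        (imRot θ ((p : ℝ) : ℂ) + √(z - x * Real.cos (2 * θ) - y * Real.sin (2 * θ)))) := by
    intro θ
    rw [isGreatest_imRot_iff, hc, hc]
    have hroot : ∀ μ : ℝ, (nrPoly A θ).IsRoot (μ : ℂ) ↔
        (μ + p * Real.sin θ) ^ 2 = z - x * Real.cos (2 * θ) - y * Real.sin (2 * θ) ∨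
        (μ - p * Real.sin θ) ^ 2 = z - x * Real.cos (2 * θ) - y * Real.sin (2 * θ) := by
      intro μ
      rw [h, IsRoot.def]
      simp only [eval_add, eval_sub, eval_mul, eval_pow, eval_X, eval_C]
      rw [mul_eq_zero]
      norm_cast
      apply or_congr <;> constructor <;> intro h <;> linarith
    have hq : 0 ≤ z - x * Real.cos (2 * θ) - y * Real.sin (2 * θ) := by
      have := (isGreatest_range_cos_sin x y).2 ⟨2 * θ, rfl⟩
      dsimp only at this
      linarith
    generalize z - x * Real.cos (2 * θ) - y * Real.sin (2 * θ) = q at *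
    have hs := Real.sq_sqrt hq
    constructor
    · rw [Set.mem_ofPred_eq, hroot]
      rcases max_choice (-(Real.sin θ * -p) + √q) (-(Real.sin θ * p) + √q) with e | e <;> rw [e]
      · right
        rw [← hs]; ring_nf; simp
      · left
        rw [← hs]; ring_nf; simp
    · intro μ hμ
      rw [Set.mem_ofPred_eq, hroot] at hμ
      rw [le_max_iff]
      rcases hμ with hμ | hμ
      · right
        have := Real.le_sqrt_of_sq_le hμ.le
        linarith
      · left
        have := Real.le_sqrt_of_sq_le hμ.le
        linarith
  refine ⟨E₁, E₂, _, _, h₁, h₂, ?_, fun hsub => ?_, fun hsub => ?_, ?_⟩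
  · norm_cast
    linarith
  · have h3 := (isGreatest_imRot_convexHull (hg₂ (Real.pi / 2))).2
      (Set.image_mono hsub (hg₁ (Real.pi / 2)).1)
    rw [hc, hc, Real.sin_pi_div_two] at h3
    linarith
  · have h3 := (isGreatest_imRot_convexHull (hg₁ (-(Real.pi / 2)))).2
      (Set.image_mono hsub (hg₂ (-(Real.pi / 2))).1)
    rw [hc, hc, Real.sin_neg, Real.sin_pi_div_two] at h3
    linarith
  · exact Set.Subset.antisymm
      (subset_of_isGreatest_imRot
        (isCompact_convexHull_union h₁.isCompact_convexHull h₂.isCompact_convexHull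
          h₁.nonempty h₂.nonempty) (convex_convexHull ℝ _) fun θ => ⟨_, hnr θ, hunion θ⟩)
      (subset_of_isGreatest_imRot (isCompact_numericalRange A) (convex_numericalRange A)
        fun θ => ⟨_, hunion θ, hnr θ⟩)

theorem theorem3p1 (α : ℂ) (B : Matrix (Fin 2) (Fin 2) ℂ) (β₁ β₂ : ℝ)
    (hβ : (ℑ B : Matrix (Fin 2) (Fin 2) ℂ).charpoly.roots = {(β₁ : ℂ), (β₂ : ℂ)}) :
    (IsBiElliptical (numericalRange (blockMat α B)) ↔
      ¬ IsStarNormal B ∧ SpectralCondition α B β₁ β₂) ∧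
    (¬ IsStarNormal B → SpectralCondition α B β₁ β₂ →
      ∀ p x y z : ℝ,
        p = |β₁ - β₂| / (2 * Real.sqrt (1 + α.im ^ 2)) →
        x = ((∑ i, ∑ j, ‖B i j‖ ^ 2) - 2) / 4 + (α ^ 2).re / 2 - p ^ 2 / 2 →
        y = (β₁ + β₂) / 2 + (α ^ 2).im / 2 →
        z = ((∑ i, ∑ j, ‖B i j‖ ^ 2) + 2) / 4 + ‖α‖ ^ 2 / 2 - p ^ 2 / 2 →
        0 < p ∧ Real.sqrt (x ^ 2 + y ^ 2) < z ∧
        ∀ θ : ℝ,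
          nrPoly (blockMat α B) θ =
            ((Polynomial.X + Polynomial.C ((p * Real.sin θ : ℝ) : ℂ)) ^ 2 +
                Polynomial.C
                  ((x * Real.cos (2 * θ) + y * Real.sin (2 * θ) - z : ℝ) : ℂ)) *
              ((Polynomial.X - Polynomial.C ((p * Real.sin θ : ℝ) : ℂ)) ^ 2 +
                Polynomial.C
                  ((x * Real.cos (2 * θ) + y * Real.sin (2 * θ) - z : ℝ) : ℂ))) := by
  obtain ⟨r, j, rfl⟩ := exists_eq_pauli B
  obtain ⟨hβ₁, hβ₂⟩ := imaginaryPart_pauli_roots hβ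
  refine ⟨⟨fun h => ?_, fun ⟨hn, hs⟩ => ?_⟩, fun hn hs p x y z hp hx hy hz =>
    nrPoly_factorization hβ₁ hβ₂ hn hs hp hx hy hz⟩
  · obtain ⟨p, hp, hn⟩ := gapForm_eq_of_isBiElliptical h
    refine ⟨hn, (spectralCondition_iff α hβ₂ ?_).mpr hp⟩
    have h01 := hp 0 1
    rw [gapForm, meanForm] at h01
    linear_combination -h01 / 4
  · obtain ⟨hp, hz, hP⟩ := nrPoly_factorization hβ₁ hβ₂ hn hs rfl rfl rfl rfl
    exact isBiElliptical_of_nrPoly hp hz hP
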